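/- For each $k\ge 1$ consider $k$ alternatives; alternative $i$ yields observations $X_{i,j}=\mu_i+\sigma_i Y_{i,j}$, $j=1,2,\dots$, where the $Y_{i,j}$ are i.i.d. over all $i,j$, with a continuous (atomless) distribution, $\mathrm{E}[Y_{i,j}]=0$ and $\mathrm{Var}[Y_{i,j}]=1$. The means and standard deviations of alternatives $2,\dots,k$ may depend on $k$; alternative 1 is the same for all $k$. Assume there are positive constants $\gamma,\underline\sigma,\overline\sigma$, independent of $k$, such that $\mu_1-\mu_i\ge\gamma$ for $i=2,\dots,k$ and $\underline\sigma\le\sigma_i\le\overline\sigma$ for $i=1,\dots,k$. Let $f:\{1,2,\dots\}\to[0,\infty)$ satisfy $\lim_{n\to\infty}f(n)=0$, and put $U_i(n)=\frac1n\sum_{j=1}^n X_{i,j}+f(n)$ and $U_1^*=\inf_{n\ge1}U_1(n)$. The meta-UCB algorithm with budget $B$ takes one observation of every alternative; then, as long as the total number of observations is less than $B$, it takes one more observation of an alternative that maximizes $U_i(n_i)$, where $n_i$ is the current sample size of $i$; finally it selects an alternative with the largest $n_i$. Ties are broken arbitrarily. Let PCS be the probability that alternative 1 is selected. For $b>0$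 let $n^f(b)$ be a positive integer such that $f(n)<b$ for all $n\ge n^f(b)$, chosen left-continuously in $b$ (for example the smallest such integer), and for $x,y,z>0$ let $$C^f(x,y,z)=n^f\!\left(\tfrac{xy}{2z}\right)\exp\!\left(\frac{2z^2\pi^2}{3x^2\,n^f\!\left(\frac{xy}{2z}\right)}\right).$$ Let $B=ck$ with $c>2C^f(\gamma,\underline\sigma,\overline\sigma)$. Then the set $\{g\in(0,\gamma):2C^f(\gamma-g,\underline\sigma,\overline\sigma)\le c\}$ is non-empty, and with $\gamma_0$ its supremum, $$\liminf_{k\to\infty}\mathrm{PCS}\ \ge\ \Pr\{U_1^*\ge\mu_1-\gamma_0\}\ >\ 0.$$ In particular the meta-UCB algorithm is sample optimal: there are constants $\alpha\in(0,1)$ and $c>0$ such that $\liminf_{k\to\infty}\mathrm{PCS}>\alpha$ for $B=ck$. -/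

import Mathlib

open Filter Topology MeasureTheory ProbabilityTheory

noncomputable section

/-- The sample mean of the first `n` terms of the observation sequence `x`. -/
def sampleMean (x : ℕ → ℝ) (n : ℕ) : ℝ :=
  (∑ j ∈ Finset.range n, x j) / n

/-- The UCB value after `n` observations: sample mean plus exploration bonus. -/
def ucbValue (f : ℕ → ℝ) (x : ℕ → ℝ) (n : ℕ) : ℝ :=
  sampleMean x n + f n

/-- The infimum over all `n ≥ 1` of the UCB value process. It is taken in the extended reals, so
that it is the true infimum also on paths that are not bounded below. -/
def ucbInf (f : ℕ → ℝ) (x : ℕ → ℝ) : EReal :=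
  ⨅ n : ℕ, ⨅ _ : 1 ≤ n, ((ucbValue f x n : ℝ) : EReal)

/-- The exploration bonus function is non-negative on sample sizes `n ≥ 1` and vanishes at
infinity. -/
structure IsBonusFunction (f : ℕ → ℝ) : Prop where
  nonneg : ∀ n, 1 ≤ n → 0 ≤ f n
  tendsto_zero : Tendsto f atTop (𝓝 0)

/-- `b` is a possible output of the meta-UCB algorithm with alternatives `0, …, k - 1` and budget
`B` on the sample path on which alternative `i` has UCB value `U i m` after `m` observations.
Here `n t i` is the sample size of `i` after `t` rounds of the while loop, and `T` is the number of
rounds. Ties, both in the sampling rule and in the final selection, may be broken arbitrarily. -/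
def IsMetaUCBOutput (k : ℕ) (B : ℝ) (U : ℕ → ℕ → ℝ) (b : ℕ) : Prop :=
  ∃ (n : ℕ → ℕ → ℕ) (T : ℕ),
    (∀ i < k, n 0 i = 1) ∧
    (∀ t < T, ((∑ i ∈ Finset.range k, n t i : ℕ) : ℝ) < B ∧
      ∃ s < k, (∀ i < k, U i (n t i) ≤ U s (n t s)) ∧
        n (t + 1) = Function.update (n t) s (n t s + 1)) ∧
    B ≤ ((∑ i ∈ Finset.range k, n T i : ℕ) : ℝ) ∧
    b < k ∧ ∀ i < k, n T i ≤ n T b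

/-- `nf b` is a positive integer from which on `f` is below `b`. The choice is left-continuous
in `b`, as the choice of the smallest such integer is. -/
structure IsBonusThreshold (f : ℕ → ℝ) (nf : ℝ → ℕ) : Prop where
  one_le : ∀ b, 0 < b → 1 ≤ nf b
  lt_of_le : ∀ b, 0 < b → ∀ n, nf b ≤ n → f n < b
  left_continuous : ∀ b, 0 < b → ∀ᶠ b' in 𝓝[<] b, nf b' = nf b

/-- The constant `C^f(x, y, z)`, for the choice `nf` of thresholds for `f`. -/
def costConstant (nf : ℝ → ℕ) (x y z : ℝ) : ℝ :=
  (nf (x * y / (2 * z)) : ℝ) *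
    Real.exp (2 * z ^ 2 * Real.pi ^ 2 / (3 * x ^ 2 * (nf (x * y / (2 * z)) : ℝ)))

/-- Sample optimality, for an algorithm whose probability of correct selection with `k`
alternatives and budget `B` is `PCS k B`. -/
def IsSampleOptimal (PCS : ℕ → ℝ → ℝ) : Prop :=
  ∃ α ∈ Set.Ioo (0 : ℝ) 1, ∃ c > 0, α < liminf (fun k : ℕ => PCS k (c * k)) atTop

/-- The observations `Y i j` of the standardized reference variables are i.i.d. over all
alternatives `i` and all observation numbers `j`, with an atomless law of mean zero and unit
variance. -/
structure IsReferenceNoise {Ω : Type*} [MeasurableSpace Ω] (P : Measure Ω)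
    (Y : ℕ → ℕ → Ω → ℝ) : Prop where
  measurable : ∀ i j, Measurable (Y i j)
  indep : iIndepFun (fun (p : ℕ × ℕ) => Y p.1 p.2) P
  identDistrib : ∀ i j, IdentDistrib (Y i j) (Y 0 0) P P
  continuous_law : ∀ y : ℝ, P {ω | Y 0 0 ω = y} = 0
  memLp : MemLp (Y 0 0) 2 P
  mean_zero : ∫ ω, Y 0 0 ω ∂P = 0
  variance_one : variance (Y 0 0) P = 1

/-- The observation sequence `X_j = m + s Y_j` of an alternative with mean `m` and standard
deviation `s`. -/
def observations (m s : ℝ) (y : ℕ → ℝ) (j : ℕ) : ℝ :=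
  m + s * y j

end

/-! Fix `g` in `(0, γ)` and put `x = γ - g`, `a = x / (2 * σhi)`, `r = nf (x * σlo / (2 * σhi))`.
Let `N i` be the first `n ≥ r` at which the mean of the standardized noise of alternative `i` is at
most `a`. There, bonus and scaled noise mean together are below `x`, so the UCB value of an inferior
`i` lies below `μ₁ - g`. If the best alternative never goes below that level, `i` is never sampled
beyond `N i`, and a budget above `2 * ∑ N i` forces the correct selection
(`IsMetaUCBOutput.eq_zero`). Since `N i` depends on the noise only, the `N i` form one i.i.d.
sequence for all `k`, and the strong law gives `∑ N i < c * k / 2` eventually as soon as `E[N] < c /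
2`.

The mean is bounded by `r + 1 / a ^ 2` (`IsIIDNoise.sum_integral_aliveIndicator_le`), which is less
than the cost constant (`lt_costConstant`). The bound stops the walk with steps `1 - X m / a` at `N
∧ n`: Wald's identity gives its mean, and its positive part has a small second moment because the
walk is nonpositive before the stopping step. Cauchy-Schwarz then yields a quadratic inequality for
`E[N ∧ n]`.

The supremum `γ₀` need not itself be admissible. As the noise is atomless, the UCB infimum almost
surely avoids the level `μ₁ - γ₀` (`IsReferenceNoise.ae_exists_lt_of_le_ucbInf`), so an admissible
`g < γ₀` or `g = γ₀` suffices on each path, and a Fatou argument gives the liminf. Positivity holds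
because a walk with positive drift can stay nonnegative forever
(`IsReferenceNoise.measure_forall_nonneg_pos`). -/

section

/-! ### Independence of subfamilies and i.i.d. noise sequences. -/

variable {Ω : Type*} [MeasurableSpace Ω] {P : Measure Ω}

omit [MeasurableSpace Ω] in
theorem comap_reindex_le_iSup {ι δ : Type*} (X : ι → Ω → ℝ) (s : δ → ι) :
    MeasurableSpace.comap (fun ω a => X (s a) ω) MeasurableSpace.pi ≤
      ⨆ i ∈ Set.range s, MeasurableSpace.comap (X i) inferInstance := by
  rw [MeasurableSpace.pi, MeasurableSpace.comap_iSup]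
  refine iSup_le fun a => ?_
  rw [MeasurableSpace.comap_comp]
  exact le_iSup₂_of_le (s a) ⟨a, rfl⟩ le_rfl

/-- Disjoint subfamilies generate independent σ-algebras, also when they are infinite. This
separates past from present, one row from another, and initial steps from a tail. -/
theorem iIndepFun_indepFun_reindex {ι α β : Type*} {X : ι → Ω → ℝ} (h : iIndepFun X P)
    (hm : ∀ i, Measurable (X i)) (e : α → ι) (e' : β → ι) (hd : ∀ a b, e a ≠ e' b) :
    IndepFun (fun ω a => X (e a) ω) (fun ω b => X (e' b) ω) P := by
  have hdisj : Disjoint (Set.range e) (Set.range e') := by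
    rw [Set.disjoint_left]
    rintro _ ⟨a, rfl⟩ ⟨b, hb⟩
    exact hd a b hb.symm
  have key := indep_iSup_of_disjoint (fun i => (hm i).comap_le) h.iIndep hdisj
  rw [IndepFun_iff_Indep]
  exact indep_of_indep_of_le_left (indep_of_indep_of_le_right key (comap_reindex_le_iSup X e'))
    (comap_reindex_le_iSup X e)

/-- A sequence of i.i.d. random variables of mean zero and unit variance. -/
structure IsIIDNoise (P : Measure Ω) (X : ℕ → Ω → ℝ) : Prop where
  measurable : ∀ j, Measurable (X j)
  indep : iIndepFun X P
  identDistrib : ∀ j, IdentDistrib (X j) (X 0) P P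
  memLp : ∀ j, MemLp (X j) 2 P
  integral_eq : ∀ j, ∫ ω, X j ω ∂P = 0
  integral_sq : ∀ j, ∫ ω, X j ω ^ 2 ∂P = 1

theorem IsReferenceNoise.isIIDNoise [IsProbabilityMeasure P] {Y : ℕ → ℕ → Ω → ℝ}
    (hY : IsReferenceNoise P Y) {e : ℕ → ℕ × ℕ} (he : e.Injective) :
    IsIIDNoise P (fun j => Y (e j).1 (e j).2) where
  measurable j := hY.measurable _ _
  indep := hY.indep.precomp he
  identDistrib j := (hY.identDistrib _ _).trans (hY.identDistrib _ _).symm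
  memLp j := (hY.identDistrib _ _).memLp_iff.2 hY.memLp
  integral_eq j := by rw [(hY.identDistrib _ _).integral_eq, hY.mean_zero]
  integral_sq j := by
    have h1 := ((hY.identDistrib (e j).1 (e j).2).comp (u := fun x : ℝ => x ^ 2)
      (by fun_prop)).integral_eq
    have h2 := hY.variance_one
    rw [variance_of_integral_eq_zero hY.memLp.1.aemeasurable hY.mean_zero] at h2
    exact h1.trans h2

/-- The right side does not involve `e`, so changing the row or shifting time leaves the law of the
whole sequence unchanged. -/
theorem IsReferenceNoise.map_reindex_eq [IsProbabilityMeasure P] {Y : ℕ → ℕ → Ω → ℝ}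
    (hY : IsReferenceNoise P Y) {e : ℕ → ℕ × ℕ} (he : e.Injective) :
    P.map (fun ω j => Y (e j).1 (e j).2 ω) = Measure.infinitePi fun _ => P.map (Y 0 0) := by
  rw [(hY.isIIDNoise he).indep.map_fun_eq_infinitePi_map (hY.isIIDNoise he).measurable]
  congr! 2 with j
  exact (hY.identDistrib _ _).map_eq

theorem IsReferenceNoise.identDistrib_reindex [IsProbabilityMeasure P] {Y : ℕ → ℕ → Ω → ℝ}
    (hY : IsReferenceNoise P Y) {e e' : ℕ → ℕ × ℕ} (he : e.Injective) (he' : e'.Injective) :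
    IdentDistrib (fun ω j => Y (e j).1 (e j).2 ω) (fun ω j => Y (e' j).1 (e' j).2 ω) P P where
  aemeasurable_fst := (measurable_pi_lambda _ fun _ => hY.measurable _ _).aemeasurable
  aemeasurable_snd := (measurable_pi_lambda _ fun _ => hY.measurable _ _).aemeasurable
  map_eq := by rw [hY.map_reindex_eq he, hY.map_reindex_eq he']

namespace IsIIDNoise

variable {X : ℕ → Ω → ℝ}

theorem integrable [IsProbabilityMeasure P] (hX : IsIIDNoise P X) (j : ℕ) :
    Integrable (X j) P := (hX.memLp j).integrable (by norm_num)

theorem ae_tendsto_mean [IsProbabilityMeasure P] (hX : IsIIDNoise P X) :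
    ∀ᵐ ω ∂P, Tendsto (fun n : ℕ => (∑ j ∈ Finset.range n, X j ω) / n) atTop (𝓝 0) := by
  have h := strong_law_ae_real X (hX.integrable 0) (fun i j hij => hX.indep.indepFun hij)
    hX.identDistrib
  rwa [hX.integral_eq] at h

theorem integral_sum_sq [IsProbabilityMeasure P] (hX : IsIIDNoise P X) (n : ℕ) :
    ∫ ω, (∑ j ∈ Finset.range n, X j ω) ^ 2 ∂P = n := by
  have h0 : ∫ ω, (∑ j ∈ Finset.range n, X j) ω ∂P = 0 := by
    simp only [Finset.sum_apply]
    rw [integral_finsetSum _ fun j _ => hX.integrable j]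
    simp [hX.integral_eq]
  have hv := IndepFun.variance_sum (μ := P) (X := X) (s := Finset.range n)
    (fun j _ => hX.memLp j) (fun i _ j _ hij => hX.indep.indepFun hij)
  rw [variance_of_integral_eq_zero (X := ∑ j ∈ Finset.range n, X j)
    (Finset.aemeasurable_sum _ fun j _ => (hX.measurable j).aemeasurable) h0] at hv
  simp only [Finset.sum_apply] at hv
  rw [hv]
  have : ∀ j, variance (X j) P = 1 := fun j => by
    rw [variance_of_integral_eq_zero (hX.measurable j).aemeasurable (hX.integral_eq j),
      hX.integral_sq]
  simp [this]

/-- A function of the first `m` terms is independent of the `m`-th one. -/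
theorem integral_mul_of_past [IsProbabilityMeasure P] (hX : IsIIDNoise P X) (m : ℕ)
    {φ : (Fin m → ℝ) → ℝ} (hφ : Measurable φ) {ψ : ℝ → ℝ} (hψ : Measurable ψ) :
    ∫ ω, φ (fun j => X j ω) * ψ (X m ω) ∂P =
      (∫ ω, φ (fun j => X j ω) ∂P) * ∫ ω, ψ (X m ω) ∂P := by
  have h := iIndepFun_indepFun_reindex hX.indep hX.measurable (fun j : Fin m => (j : ℕ))
    (fun _ : Unit => m) (fun a _ => a.2.ne)
  have h' := h.comp (φ := φ) (ψ := fun u : Unit → ℝ => ψ (u ())) hφ (by fun_prop)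
  have hm : Measurable fun ω => fun j : Fin m => X j ω :=
    measurable_pi_lambda _ fun _ => hX.measurable _
  exact h'.integral_fun_mul_eq_mul_integral (hφ.comp hm).aestronglyMeasurable
    (hψ.comp (hX.measurable m)).aestronglyMeasurable

end IsIIDNoise

end

/-! ### Passage times of the noise means and a bound on their expectation. -/

section

/-- The partial means of `y` exceed the level `a` at all times between `r` and `m`. -/
def StaysAbove (a : ℝ) (r m : ℕ) (y : ℕ → ℝ) : Prop :=
  ∀ n, r ≤ n → n ≤ m → a * n < ∑ j ∈ Finset.range n, y j

/-- The first time from `r` on at which the partial mean of `y` is at most `a`. -/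
noncomputable def passageTime (a : ℝ) (r : ℕ) (y : ℕ → ℝ) : ℕ :=
  sInf {n | r ≤ n ∧ ∑ j ∈ Finset.range n, y j ≤ a * n}

theorem staysAbove_of_lt_passageTime {a : ℝ} {r m : ℕ} {y : ℕ → ℝ}
    (h : m < passageTime a r y) : StaysAbove a r m y := by
  intro n hr hn
  by_contra hc
  exact absurd (Nat.sInf_le (s := {n | r ≤ n ∧ ∑ j ∈ Finset.range n, y j ≤ a * n})
    ⟨hr, not_lt.1 hc⟩) (not_le.2 (lt_of_le_of_lt hn h))

theorem passageTime_spec {a : ℝ} {r : ℕ} {y : ℕ → ℝ}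
    (h : ∃ n, r ≤ n ∧ ∑ j ∈ Finset.range n, y j ≤ a * n) :
    r ≤ passageTime a r y ∧
      ∑ j ∈ Finset.range (passageTime a r y), y j ≤ a * (passageTime a r y : ℕ) :=
  Nat.sInf_mem (s := {n | r ≤ n ∧ ∑ j ∈ Finset.range n, y j ≤ a * n}) h

theorem measurableSet_staysAbove (a : ℝ) (r m : ℕ) : MeasurableSet {y | StaysAbove a r m y} := by
  simp only [StaysAbove, Set.ofPred_forall]
  refine MeasurableSet.iInter fun n => MeasurableSet.iInter fun _ => MeasurableSet.iInter fun _ => ?_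
  exact measurableSet_lt measurable_const (by fun_prop)

theorem measurable_passageTime (a : ℝ) (r : ℕ) : Measurable (passageTime a r) := by
  refine measurable_to_countable' fun n => ?_
  have hm : ∀ n : ℕ, MeasurableSet {y : ℕ → ℝ | ∑ j ∈ Finset.range n, y j ≤ a * n} := fun n =>
    measurableSet_le (by fun_prop) measurable_const
  have hn : ∀ n : ℕ, MeasurableSet {y : ℕ → ℝ | r ≤ n ∧ ∑ j ∈ Finset.range n, y j ≤ a * n} :=
    fun n => (MeasurableSet.const _).inter (hm n)
  have heq : passageTime a r ⁻¹' {n} =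
      {y | ((r ≤ n ∧ ∑ j ∈ Finset.range n, y j ≤ a * n) ∧
        ∀ l < n, ¬ (r ≤ l ∧ ∑ j ∈ Finset.range l, y j ≤ a * l)) ∨
        -- Paths that never pass get the default value `sInf ∅ = 0`.
        (n = 0 ∧ ∀ l : ℕ, ¬ (r ≤ l ∧ ∑ j ∈ Finset.range l, y j ≤ a * l))} := by
    ext y
    simp only [Set.mem_preimage, Set.mem_singleton_iff, Set.mem_ofPred_eq]
    constructor
    · intro h
      by_cases hex : ∃ n : ℕ, r ≤ n ∧ ∑ j ∈ Finset.range n, y j ≤ a * n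
      · left
        have hs := passageTime_spec hex
        rw [h] at hs
        refine ⟨hs, fun l hl hc => ?_⟩
        rw [← h] at hl
        exact absurd (staysAbove_of_lt_passageTime hl l hc.1 le_rfl) (not_lt.2 hc.2)
      · right
        push Not at hex
        refine ⟨?_, fun l hl => absurd hl.2 (not_le.2 (hex l hl.1))⟩
        rw [← h, passageTime, Nat.sInf_eq_zero]
        right
        ext l
        simpa using hex l
    · rintro (⟨h1, h2⟩ | ⟨h1, h2⟩)
      · refine le_antisymm (Nat.sInf_le h1) (not_lt.1 fun hc => ?_)
        exact h2 _ hc (passageTime_spec ⟨n, h1⟩)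
      · rw [h1, passageTime, Nat.sInf_eq_zero]
        right
        ext l
        simpa using h2 l
  rw [heq]
  have h1 : MeasurableSet {y : ℕ → ℝ | ∀ l < n,
      ¬ (r ≤ l ∧ ∑ j ∈ Finset.range l, y j ≤ a * l)} := by
    simp only [Set.ofPred_forall]
    exact MeasurableSet.iInter fun l => MeasurableSet.iInter fun _ => (hn l).compl
  have h2 : MeasurableSet {y : ℕ → ℝ | ∀ l : ℕ,
      ¬ (r ≤ l ∧ ∑ j ∈ Finset.range l, y j ≤ a * l)} := by
    simp only [Set.ofPred_forall]
    exact MeasurableSet.iInter fun l => (hn l).compl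
  exact ((hn n).inter h1).union ((MeasurableSet.const _).inter h2)

open Classical in
/-- The indicator of `StaysAbove a r m`, as a real number. -/
noncomputable def aliveIndicator (a : ℝ) (r m : ℕ) (y : ℕ → ℝ) : ℝ :=
  if StaysAbove a r m y then 1 else 0

theorem aliveIndicator_nonneg (a : ℝ) (r m : ℕ) (y : ℕ → ℝ) : 0 ≤ aliveIndicator a r m y := by
  unfold aliveIndicator; split_ifs <;> norm_num

theorem aliveIndicator_le_one (a : ℝ) (r m : ℕ) (y : ℕ → ℝ) : aliveIndicator a r m y ≤ 1 := by
  unfold aliveIndicator; split_ifs <;> norm_num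

theorem aliveIndicator_of_lt {a : ℝ} {r m : ℕ} (h : m < r) (y : ℕ → ℝ) :
    aliveIndicator a r m y = 1 :=
  if_pos fun _ h1 h2 => absurd (h1.trans h2) (not_le.2 h)

theorem measurable_aliveIndicator (a : ℝ) (r m : ℕ) : Measurable (aliveIndicator a r m) :=
  Measurable.ite (measurableSet_staysAbove a r m) measurable_const measurable_const

theorem aliveIndicator_congr {a : ℝ} {r m : ℕ} {y z : ℕ → ℝ} (h : ∀ j < m, y j = z j) :
    aliveIndicator a r m y = aliveIndicator a r m z := by
  have : StaysAbove a r m y ↔ StaysAbove a r m z := by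
    refine forall_congr' fun n => imp_congr_right fun _ => imp_congr_right fun hn => ?_
    rw [Finset.sum_congr rfl fun j hj => h j (lt_of_lt_of_le (Finset.mem_range.1 hj) hn)]
  unfold aliveIndicator
  split_ifs <;> tauto

/-- The stopped walk with steps `1 - y j / a`: its value is a past value plus at most one step. -/
theorem sq_posPart_stopped_le {a : ℝ} (ha : 0 < a) (r : ℕ) (y : ℕ → ℝ) {n : ℕ} (hn : r ≤ n) :
    max 0 (∑ m ∈ Finset.range n, (1 - y m / a) * aliveIndicator a r m y) ^ 2 ≤
      (∑ m ∈ Finset.range r, (1 - y m / a)) ^ 2 +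
        ∑ m ∈ Finset.Ico r n, (1 - y m / a) ^ 2 * aliveIndicator a r m y := by
  have hr : ∀ n, (∀ m < n, aliveIndicator a r m y = 1) →
      ∑ m ∈ Finset.range n, (1 - y m / a) * aliveIndicator a r m y =
        ∑ m ∈ Finset.range n, (1 - y m / a) := fun n h =>
    Finset.sum_congr rfl fun m hm => by rw [h m (Finset.mem_range.1 hm), mul_one]
  induction n, hn using Nat.le_induction with
  | base =>
    rw [hr r fun m hm => aliveIndicator_of_lt hm y]
    simp only [Finset.Ico_self, Finset.sum_empty, add_zero]
    rcases le_total 0 (∑ m ∈ Finset.range r, (1 - y m / a)) with h | h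
    · rw [max_eq_right h]
    · rw [max_eq_left h, zero_pow two_ne_zero]; positivity
  | succ n hn ih =>
    rw [Finset.sum_range_succ, Finset.sum_Ico_succ_top hn]
    by_cases hs : StaysAbove a r n y
    · have h1 : ∀ m ≤ n, aliveIndicator a r m y = 1 := fun m hm =>
        if_pos fun l hl hl' => hs l hl (hl'.trans hm)
      rw [hr n fun m hm => h1 m hm.le, h1 n le_rfl, mul_one, mul_one]
      -- While the partial mean exceeds `a` the walk is nonpositive, so the positive part after one
      -- more step is at most the absolute value of that step.
      have h2 : ∑ m ∈ Finset.range n, (1 - y m / a) ≤ 0 := by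
        have h3 := hs n hn le_rfl
        rw [Finset.sum_sub_distrib, ← Finset.sum_div]
        simp only [Finset.sum_const, Finset.card_range, nsmul_eq_mul, mul_one]
        rw [sub_nonpos, le_div_iff₀ ha]
        linarith
      have h4 : 0 ≤ (∑ m ∈ Finset.range r, (1 - y m / a)) ^ 2 +
          ∑ m ∈ Finset.Ico r n, (1 - y m / a) ^ 2 * aliveIndicator a r m y :=
        add_nonneg (sq_nonneg _) (Finset.sum_nonneg fun m _ =>
          mul_nonneg (sq_nonneg _) (aliveIndicator_nonneg _ _ _ _))
      have h5 : max 0 (∑ m ∈ Finset.range n, (1 - y m / a) + (1 - y n / a)) ^ 2 ≤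
          (1 - y n / a) ^ 2 := by
        rw [sq_le_sq, abs_of_nonneg (le_max_left _ _)]
        exact max_le (abs_nonneg _) (by linarith [le_abs_self (1 - y n / a)])
      linarith
    · rw [show aliveIndicator a r n y = 0 from if_neg hs]
      simpa using ih

variable {Ω : Type*} [MeasurableSpace Ω] {P : Measure Ω} [IsProbabilityMeasure P]
  {X : ℕ → Ω → ℝ}

theorem IsIIDNoise.integral_mul_aliveIndicator (hX : IsIIDNoise P X) (a : ℝ) (r m : ℕ)
    {ψ : ℝ → ℝ} (hψ : Measurable ψ) :
    ∫ ω, ψ (X m ω) * aliveIndicator a r m (fun j => X j ω) ∂P =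
      (∫ ω, ψ (X m ω) ∂P) * ∫ ω, aliveIndicator a r m (fun j => X j ω) ∂P := by
  -- Padding with zeros exhibits the indicator as a measurable function of the first `m` terms, on
  -- which alone it depends.
  have hext : Measurable fun (u : Fin m → ℝ) (j : ℕ) => if h : j < m then u ⟨j, h⟩ else 0 := by
    refine measurable_pi_lambda _ fun j => ?_
    by_cases h : j < m
    · simpa [h] using measurable_pi_apply _
    · simp [h]
  have h := hX.integral_mul_of_past m ((measurable_aliveIndicator a r m).comp hext) hψ
  have hc : ∀ ω, ((aliveIndicator a r m).comp
      fun (u : Fin m → ℝ) (j : ℕ) => if h : j < m then u ⟨j, h⟩ else 0)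
        (fun j : Fin m => X j ω) = aliveIndicator a r m fun j => X j ω := fun ω =>
    aliveIndicator_congr fun j hj => by simp [hj]
  simp only [hc] at h
  rw [mul_comm, ← h]
  simp only [mul_comm]

omit [IsProbabilityMeasure P] in
theorem IsIIDNoise.measurable_seq (hX : IsIIDNoise P X) : Measurable fun ω j => X j ω :=
  measurable_pi_lambda _ hX.measurable

omit [IsProbabilityMeasure P] in
theorem IsIIDNoise.integrable_mul_aliveIndicator (hX : IsIIDNoise P X) (a : ℝ) (r m : ℕ)
    {g : Ω → ℝ} (hg : Integrable g P) :
    Integrable (fun ω => g ω * aliveIndicator a r m (fun j => X j ω)) P :=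
  hg.mul_bdd (c := 1) ((measurable_aliveIndicator a r m).comp
    hX.measurable_seq).aestronglyMeasurable <| ae_of_all _ fun ω => by
      rw [Real.norm_eq_abs, abs_of_nonneg (aliveIndicator_nonneg _ _ _ _)]
      exact aliveIndicator_le_one _ _ _ _

omit [IsProbabilityMeasure P] in
theorem IsIIDNoise.integrable_sq (hX : IsIIDNoise P X) (j : ℕ) :
    Integrable (fun ω => X j ω ^ 2) P := (hX.memLp j).integrable_sq

theorem IsIIDNoise.memLp_step (hX : IsIIDNoise P X) (a : ℝ) (j : ℕ) :
    MemLp (fun ω => 1 - X j ω / a) 2 P := by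
  have h := (memLp_const (1 : ℝ)).sub ((hX.memLp j).const_mul a⁻¹)
  simp only [div_eq_inv_mul]
  exact h

theorem IsIIDNoise.integral_step (hX : IsIIDNoise P X) (a : ℝ) (j : ℕ) :
    ∫ ω, (1 - X j ω / a) ∂P = 1 := by
  rw [integral_sub (integrable_const _) ((hX.integrable j).div_const a), integral_div,
    hX.integral_eq]
  simp

theorem IsIIDNoise.integral_step_sq (hX : IsIIDNoise P X) (a : ℝ) (j : ℕ) :
    ∫ ω, (1 - X j ω / a) ^ 2 ∂P = 1 + 1 / a ^ 2 := by
  have : ∀ ω, (1 - X j ω / a) ^ 2 = (1 - (2 / a) * X j ω) + (1 / a ^ 2) * X j ω ^ 2 := fun ω => by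
    ring
  simp only [this]
  rw [integral_add (f := fun ω => 1 - (2 / a) * X j ω)
    ((integrable_const _).sub ((hX.integrable j).const_mul _)) ((hX.integrable_sq j).const_mul _), integral_sub (integrable_const _)
    ((hX.integrable j).const_mul _), integral_const_mul, integral_const_mul, hX.integral_eq,
    hX.integral_sq]
  simp

theorem IsIIDNoise.integral_sum_step_sq (hX : IsIIDNoise P X) (a : ℝ) (r : ℕ) :
    ∫ ω, (∑ m ∈ Finset.range r, (1 - X m ω / a)) ^ 2 ∂P = r ^ 2 + r / a ^ 2 := by
  have : ∀ ω, (∑ m ∈ Finset.range r, (1 - X m ω / a)) ^ 2 =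
      ((r : ℝ) ^ 2 - (2 * r / a) * ∑ m ∈ Finset.range r, X m ω) +
        (1 / a ^ 2) * (∑ m ∈ Finset.range r, X m ω) ^ 2 := fun ω => by
    rw [Finset.sum_sub_distrib, ← Finset.sum_div]
    simp only [Finset.sum_const, Finset.card_range, nsmul_eq_mul, mul_one]
    ring
  simp only [this]
  have hi : Integrable (fun ω => ∑ m ∈ Finset.range r, X m ω) P :=
    integrable_finsetSum _ fun j _ => hX.integrable j
  have hi2 : Integrable (fun ω => (∑ m ∈ Finset.range r, X m ω) ^ 2) P :=
    (memLp_finsetSum _ fun j _ => hX.memLp j).integrable_sq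
  rw [integral_add (f := fun ω => (r : ℝ) ^ 2 - (2 * r / a) * ∑ m ∈ Finset.range r, X m ω)
    ((integrable_const _).sub (hi.const_mul _)) (hi2.const_mul _),
    integral_sub (integrable_const _) (hi.const_mul _), integral_const_mul, integral_const_mul,
    hX.integral_sum_sq, integral_finsetSum _ fun j _ => hX.integrable j]
  simp [hX.integral_eq]
  ring

/-- The expected truncated passage time: Wald's identity and the Cauchy-Schwarz inequality. -/
theorem IsIIDNoise.sum_integral_aliveIndicator_le (hX : IsIIDNoise P X) {a : ℝ} (ha : 0 < a)
    {r : ℕ} (hr : 1 ≤ r) {n : ℕ} (hn : r ≤ n) :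
    ∑ m ∈ Finset.range n, ∫ ω, aliveIndicator a r m (fun j => X j ω) ∂P ≤ r + 1 / a ^ 2 := by
  set p : ℕ → ℝ := fun m => ∫ ω, aliveIndicator a r m (fun j => X j ω) ∂P with hp
  set t := ∑ m ∈ Finset.range n, p m with ht
  set V : Ω → ℝ := fun ω => ∑ m ∈ Finset.range n,
    (1 - X m ω / a) * aliveIndicator a r m (fun j => X j ω) with hV
  have hstep : ∀ m, Integrable (fun ω => 1 - X m ω / a) P := fun m =>
    (hX.memLp_step a m).integrable (by norm_num)
  have hstep2 : ∀ m, Integrable (fun ω => (1 - X m ω / a) ^ 2) P := fun m =>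
    (hX.memLp_step a m).integrable_sq
  have hVi : Integrable V P := integrable_finsetSum _ fun m _ =>
    hX.integrable_mul_aliveIndicator a r m (hstep m)
  have hVint : ∫ ω, V ω ∂P = t := by
    rw [integral_finsetSum _ fun m _ => hX.integrable_mul_aliveIndicator a r m (hstep m)]
    refine Finset.sum_congr rfl fun m _ => ?_
    rw [hX.integral_mul_aliveIndicator a r m (ψ := fun x => 1 - x / a) (by fun_prop),
      hX.integral_step, one_mul]
  have ht0 : 0 ≤ t := Finset.sum_nonneg fun m _ => integral_nonneg fun ω =>
    aliveIndicator_nonneg _ _ _ _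
  set R : Ω → ℝ := fun ω => (∑ m ∈ Finset.range r, (1 - X m ω / a)) ^ 2 +
    ∑ m ∈ Finset.Ico r n, (1 - X m ω / a) ^ 2 * aliveIndicator a r m (fun j => X j ω) with hR
  have hR1 : Integrable (fun ω => (∑ m ∈ Finset.range r, (1 - X m ω / a)) ^ 2) P :=
    (memLp_finsetSum _ fun m _ => hX.memLp_step a m).integrable_sq
  have hR2 : Integrable (fun ω => ∑ m ∈ Finset.Ico r n,
      (1 - X m ω / a) ^ 2 * aliveIndicator a r m (fun j => X j ω)) P :=
    integrable_finsetSum _ fun m _ => hX.integrable_mul_aliveIndicator a r m (hstep2 m)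
  have hRint : ∫ ω, R ω ∂P = r ^ 2 + r / a ^ 2 + (t - r) * (1 + 1 / a ^ 2) := by
    rw [integral_add hR1 hR2, hX.integral_sum_step_sq,
      integral_finsetSum _ fun m _ => hX.integrable_mul_aliveIndicator a r m (hstep2 m)]
    have h1 : ∀ m, ∫ ω, (1 - X m ω / a) ^ 2 * aliveIndicator a r m (fun j => X j ω) ∂P =
        p m * (1 + 1 / a ^ 2) := fun m => by
      rw [hX.integral_mul_aliveIndicator a r m (ψ := fun x => (1 - x / a) ^ 2) (by fun_prop),
        hX.integral_step_sq, mul_comm]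
    -- Stopping cannot occur before time `r`, so the first `r` steps are always taken and `t - r` is
    -- the expected number of later ones.
    have h2 : ∑ m ∈ Finset.range r, p m = r := by
      rw [Finset.sum_congr rfl (g := fun _ => (1 : ℝ)) fun m hm => ?_]
      · simp
      · simp only [hp, aliveIndicator_of_lt (Finset.mem_range.1 hm)]
        simp
    rw [Finset.sum_congr rfl fun m _ => h1 m, ← Finset.sum_mul, Finset.sum_Ico_eq_sub _ hn, h2]
  have hle : ∀ ω, max 0 (V ω) ^ 2 ≤ R ω := fun ω => sq_posPart_stopped_le ha r _ hn
  have hpos : Integrable (fun ω => max 0 (V ω)) P := by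
    simpa [max_comm] using hVi.pos_part
  have hpos2 : Integrable (fun ω => max 0 (V ω) ^ 2) P :=
    (hR1.add hR2).mono' (hpos.aestronglyMeasurable.pow 2) (ae_of_all _ fun ω => by
      rw [Real.norm_of_nonneg (by positivity)]; exact hle ω)
  have hmem : MemLp (fun ω => max 0 (V ω)) 2 P :=
    (memLp_two_iff_integrable_sq hpos.aestronglyMeasurable).2 hpos2
  have hcs : (∫ ω, max 0 (V ω) ∂P) ^ 2 ≤ ∫ ω, max 0 (V ω) ^ 2 ∂P := by
    have h1 := variance_nonneg (fun ω => max 0 (V ω)) P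
    rw [variance_eq_sub hmem] at h1
    simpa using h1
  have htle : t ≤ ∫ ω, max 0 (V ω) ∂P :=
    hVint ▸ integral_mono hVi hpos fun ω => le_max_right _ _
  have hquad : t ^ 2 ≤ r ^ 2 + r / a ^ 2 + (t - r) * (1 + 1 / a ^ 2) := by
    calc t ^ 2 ≤ (∫ ω, max 0 (V ω) ∂P) ^ 2 := by gcongr
      _ ≤ ∫ ω, max 0 (V ω) ^ 2 ∂P := hcs
      _ ≤ ∫ ω, R ω ∂P := integral_mono hpos2 (hR1.add hR2) hle
      _ = _ := hRint
  by_contra hc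
  push Not at hc
  have hr' : (1 : ℝ) ≤ r := by exact_mod_cast hr
  have ha2 : 0 < 1 / a ^ 2 := by positivity
  rw [div_eq_mul_one_div] at hquad
  -- The quadratic inequality reads `t * (t - 1 - 1 / a ^ 2) ≤ r * (r - 1)`, whereas `t > r + 1 / a
  -- ^ 2` makes the left side exceed `t * (r - 1) ≥ r * (r - 1)`, up to equality when `r = 1`, where
  -- `t > 0` decides.
  nlinarith [mul_pos (sub_pos.2 hc) (by linarith : 0 < t), mul_nonneg (sub_nonneg.2 hr') ha2.le,
    mul_nonneg (sub_nonneg.2 hr') (sub_nonneg.2 hc.le)]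

omit [IsProbabilityMeasure P] in
theorem lintegral_natCast_eq_tsum (τ : Ω → ℕ) (hτ : Measurable τ) :
    ∫⁻ ω, (τ ω : ENNReal) ∂P = ∑' m : ℕ, P {ω | m < τ ω} := by
  have h : ∀ ω, (τ ω : ENNReal) = ∑' m : ℕ, Set.indicator {ω | m < τ ω} (fun _ => 1) ω := by
    intro ω
    rw [tsum_eq_sum (s := Finset.range (τ ω)) fun m hm => by
      simpa [Set.indicator] using hm]
    rw [Finset.sum_congr rfl (g := fun _ => (1 : ENNReal)) fun m hm => by
      simpa [Set.indicator] using hm]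
    simp
  have hm : ∀ m : ℕ, MeasurableSet {ω | m < τ ω} := fun m =>
    measurableSet_lt measurable_const hτ
  simp only [h]
  rw [lintegral_tsum fun m => (measurable_const.indicator (hm m)).aemeasurable]
  simp [lintegral_indicator, hm]

theorem IsIIDNoise.lintegral_passageTime_le (hX : IsIIDNoise P X) {a : ℝ} (ha : 0 < a)
    {r : ℕ} (hr : 1 ≤ r) :
    ∫⁻ ω, (passageTime a r (fun j => X j ω) : ENNReal) ∂P ≤ ENNReal.ofReal (r + 1 / a ^ 2) := by
  rw [lintegral_natCast_eq_tsum (fun ω => passageTime a r fun j => X j ω) ((measurable_passageTime a r).comp hX.measurable_seq)]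
  have hle : ∀ m, P {ω | m < passageTime a r (fun j => X j ω)} ≤
      ENNReal.ofReal (∫ ω, aliveIndicator a r m (fun j => X j ω) ∂P) := by
    intro m
    have hms : MeasurableSet {ω | StaysAbove a r m fun j => X j ω} :=
      hX.measurable_seq (measurableSet_staysAbove a r m)
    have : ∫ ω, aliveIndicator a r m (fun j => X j ω) ∂P =
        P.real {ω | StaysAbove a r m fun j => X j ω} := by
      rw [← integral_indicator_one hms]
      rfl
    rw [this, ofReal_measureReal]
    -- Only an inclusion: on a path that never passes, the passage time is 0 while the indicator
    -- stays 1.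
    exact measure_mono fun ω hω => staysAbove_of_lt_passageTime hω
  refine (ENNReal.tsum_le_tsum hle).trans ?_
  rw [ENNReal.tsum_eq_iSup_nat]
  refine iSup_le fun n => ?_
  rw [← ENNReal.ofReal_sum_of_nonneg fun m _ => integral_nonneg fun ω =>
    aliveIndicator_nonneg _ _ _ _]
  refine ENNReal.ofReal_le_ofReal ?_
  -- The truncation time must be at least `r`; enlarging it only increases the sum.
  refine le_trans ?_ (hX.sum_integral_aliveIndicator_le ha hr (le_max_left r n))
  exact Finset.sum_le_sum_of_subset_of_nonneg
    (Finset.range_mono (le_max_right r n)) fun m _ _ => integral_nonneg fun ω =>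
      aliveIndicator_nonneg _ _ _ _

theorem IsIIDNoise.integrable_passageTime (hX : IsIIDNoise P X) {a : ℝ} (ha : 0 < a)
    {r : ℕ} (hr : 1 ≤ r) :
    Integrable (fun ω => (passageTime a r (fun j => X j ω) : ℝ)) P := by
  have hm : Measurable fun ω => (passageTime a r (fun j => X j ω) : ℝ) :=
    measurable_from_top.comp ((measurable_passageTime a r).comp hX.measurable_seq)
  refine ⟨hm.aestronglyMeasurable, ?_⟩
  rw [hasFiniteIntegral_iff_ofReal (ae_of_all _ fun ω => Nat.cast_nonneg _)]
  simp only [ENNReal.ofReal_natCast]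
  exact (hX.lintegral_passageTime_le ha hr).trans_lt ENNReal.ofReal_lt_top

theorem IsIIDNoise.integral_passageTime_le (hX : IsIIDNoise P X) {a : ℝ} (ha : 0 < a)
    {r : ℕ} (hr : 1 ≤ r) :
    ∫ ω, (passageTime a r (fun j => X j ω) : ℝ) ∂P ≤ r + 1 / a ^ 2 := by
  rw [integral_eq_lintegral_of_nonneg_ae (ae_of_all _ fun ω => Nat.cast_nonneg _)
    (hX.integrable_passageTime ha hr).aestronglyMeasurable]
  simp only [ENNReal.ofReal_natCast]
  exact ENNReal.toReal_le_of_le_ofReal (by positivity) (hX.lintegral_passageTime_le ha hr)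

end

/-! ### Deterministic analysis of the algorithm. -/

section

/-- The best alternative is selected if its UCB values stay above a level that every other
alternative `i` falls below after `N i` observations, and the budget exceeds `2 * ∑ N i`. -/
theorem IsMetaUCBOutput.eq_zero {k : ℕ} {B : ℝ} {U : ℕ → ℕ → ℝ} {b : ℕ}
    (h : IsMetaUCBOutput k B U b) {L : ℝ} (hL : ∀ n, 1 ≤ n → L ≤ U 0 n) {N : ℕ → ℕ}
    (hN1 : ∀ i, 1 ≤ i → i < k → 1 ≤ N i) (hN : ∀ i, 1 ≤ i → i < k → U i (N i) < L)
    (hB : 2 * ((∑ i ∈ Finset.range k, N i : ℕ) : ℝ) < B) : b = 0 := by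
  obtain ⟨n, T, h0, hstep, hT, hbk, hb⟩ := h
  have hk : 0 < k := by omega
  have hone : ∀ t ≤ T, ∀ i < k, 1 ≤ n t i := by
    intro t
    induction t with
    | zero => intro _ i hi; exact (h0 i hi).ge
    | succ t ih =>
      intro ht i hi
      obtain ⟨_, s, _, _, hs⟩ := hstep t ht
      rw [hs, Function.update_apply]
      split_ifs
      · omega
      · exact ih (by omega) i hi
  have hle : ∀ t ≤ T, ∀ i, 1 ≤ i → i < k → n t i ≤ N i := by
    intro t
    induction t with
    | zero => intro _ i hi hik; rw [h0 i hik]; exact hN1 i hi hik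
    | succ t ih =>
      intro ht i hi hik
      obtain ⟨_, s, _, hmax, hs⟩ := hstep t ht
      have hprev := ih (by omega) i hi hik
      rw [hs, Function.update_apply]
      split_ifs with his
      · subst his
        rcases hprev.lt_or_eq with hlt | heq
        · exact hlt
        -- With exactly `N i` observations, `i` has a UCB value below `L`, hence below that of
        -- alternative 0, and cannot be the maximizer.
        · have h1 := hN i hi hik
          rw [← heq] at h1
          linarith [hmax 0 hk, hL _ (hone t (by omega) 0 hk)]
      · exact hprev
  by_contra hb0
  have hsum : ∑ i ∈ (Finset.range k).erase 0, n T i ≤ ∑ i ∈ (Finset.range k).erase 0, N i := by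
    refine Finset.sum_le_sum fun i hi => ?_
    simp only [Finset.mem_erase, Finset.mem_range] at hi
    exact hle T le_rfl i (by omega) hi.2
  -- If some `b ≠ 0` is selected, alternative 0 has at most `n T b ≤ N b` observations, so both it
  -- and the others together have at most `∑ N i`. The total is then below the budget.
  have hbN : N b ≤ ∑ i ∈ (Finset.range k).erase 0, N i :=
    Finset.single_le_sum (f := N) (fun _ _ => Nat.zero_le _) (by simp [hb0, hbk])
  have h1 := hb 0 hk
  have h2 := hle T le_rfl b (by omega) hbk
  have h3 := Finset.add_sum_erase (Finset.range k) (n T) (Finset.mem_range.2 hk)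
  have h4 := Finset.add_sum_erase (Finset.range k) N (Finset.mem_range.2 hk)
  have h5 : ∑ i ∈ Finset.range k, n T i ≤ 2 * ∑ i ∈ Finset.range k, N i := by omega
  have h6 : ((∑ i ∈ Finset.range k, n T i : ℕ) : ℝ) ≤
      2 * ((∑ i ∈ Finset.range k, N i : ℕ) : ℝ) := by exact_mod_cast h5
  linarith

theorem le_ucbInf_iff {f x : ℕ → ℝ} {c : ℝ} :
    (c : EReal) ≤ ucbInf f x ↔ ∀ n, 1 ≤ n → c ≤ ucbValue f x n := by
  simp [ucbInf, le_iInf_iff, EReal.coe_le_coe_iff]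

theorem ucbValue_observations (f : ℕ → ℝ) (m s : ℝ) (y : ℕ → ℝ) {n : ℕ} (hn : 1 ≤ n) :
    ucbValue f (observations m s y) n = m + s * ((∑ j ∈ Finset.range n, y j) / n) + f n := by
  have : (n : ℝ) ≠ 0 := by positivity
  simp only [ucbValue, sampleMean, observations, Finset.sum_add_distrib, ← Finset.mul_sum,
    Finset.sum_const, Finset.card_range, nsmul_eq_mul]
  field_simp

/-! ### Almost sure behaviour of the noise: strong laws, absence of atoms, walks with drift. -/

variable {Ω : Type*} [MeasurableSpace Ω] {P : Measure Ω} [IsProbabilityMeasure P]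

theorem IsReferenceNoise.identDistrib_row {Y : ℕ → ℕ → Ω → ℝ} (hY : IsReferenceNoise P Y)
    (i i' : ℕ) : IdentDistrib (fun ω j => Y i j ω) (fun ω j => Y i' j ω) P P :=
  hY.identDistrib_reindex (e := fun j => (i, j)) (e' := fun j => (i', j))
    (Prod.mk_right_injective i) (Prod.mk_right_injective i')

theorem IsReferenceNoise.isIIDNoise_row {Y : ℕ → ℕ → Ω → ℝ} (hY : IsReferenceNoise P Y)
    (i : ℕ) : IsIIDNoise P (Y i) :=
  hY.isIIDNoise (e := fun j => (i, j)) (Prod.mk_right_injective i)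

/-- The total passage time of the first `k` noise sequences is eventually below `c * k`, for
every `c` above the bound on the mean passage time. -/
theorem IsReferenceNoise.ae_eventually_sum_passageTime_lt {Y : ℕ → ℕ → Ω → ℝ}
    (hY : IsReferenceNoise P Y) {a : ℝ} (ha : 0 < a) {r : ℕ} (hr : 1 ≤ r) {c : ℝ}
    (hc : r + 1 / a ^ 2 < c) :
    ∀ᵐ ω ∂P, ∀ᶠ k : ℕ in atTop,
      ((∑ i ∈ Finset.range k, passageTime a r (fun j => Y i j ω) : ℕ) : ℝ) < c * k := by
  have hm : Measurable fun y => (passageTime a r y : ℝ) :=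
    measurable_from_top.comp (measurable_passageTime a r)
  have hlln := strong_law_ae_real (μ := P) (fun i ω => (passageTime a r (fun j => Y i j ω) : ℝ))
    ((hY.isIIDNoise_row 0).integrable_passageTime ha hr)
    (fun i i' hii => (iIndepFun_indepFun_reindex hY.indep (fun p => hY.measurable _ _)
      (fun j => (i, j)) (fun j => (i', j)) fun _ _ h => hii (congrArg Prod.fst h)).comp hm hm)
    (fun i => (hY.identDistrib_row i 0).comp hm)
  filter_upwards [hlln] with ω hω
  have hlt := ((hY.isIIDNoise_row 0).integral_passageTime_le ha hr).trans_lt hc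
  filter_upwards [hω.eventually_lt_const hlt, eventually_gt_atTop 0] with k hk hk0
  rw [div_lt_iff₀ (by exact_mod_cast hk0)] at hk
  push_cast
  exact hk

theorem IsReferenceNoise.ae_forall_exists_le {Y : ℕ → ℕ → Ω → ℝ}
    (hY : IsReferenceNoise P Y) {a : ℝ} (ha : 0 < a) (r : ℕ) :
    ∀ᵐ ω ∂P, ∀ i, ∃ n, r ≤ n ∧ ∑ j ∈ Finset.range n, Y i j ω ≤ a * n := by
  rw [ae_all_iff]
  intro i
  filter_upwards [(hY.isIIDNoise_row i).ae_tendsto_mean] with ω hω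
  obtain ⟨n, h1, h2, h3⟩ := ((hω.eventually_lt_const ha).and
    ((eventually_gt_atTop 0).and (eventually_ge_atTop r))).exists
  refine ⟨n, h3, ?_⟩
  rw [div_lt_iff₀ (by exact_mod_cast h2)] at h1
  exact h1.le

/-- The partial sums of the noise have no atoms. -/
theorem IsReferenceNoise.measure_sum_eq_zero {Y : ℕ → ℕ → Ω → ℝ} (hY : IsReferenceNoise P Y)
    (i : ℕ) {n : ℕ} (hn : 1 ≤ n) (s : ℝ) :
    P {ω | ∑ j ∈ Finset.range n, Y i j ω = s} = 0 := by
  obtain ⟨m, rfl⟩ : ∃ m, n = m + 1 := ⟨n - 1, by omega⟩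
  have heval : Measurable fun u : Unit → ℝ => u () := measurable_pi_apply (X := fun _ => ℝ) ()
  -- Splitting off the first term leaves an independent remainder; by Fubini, one atomless summand
  -- makes the sum atomless.
  have hind := (iIndepFun_indepFun_reindex hY.indep (fun p => hY.measurable _ _)
    (fun j : ℕ => (i, j + 1)) (fun _ : Unit => (i, 0)) (by simp)).comp
    (φ := fun u : ℕ → ℝ => ∑ j ∈ Finset.range m, u j) (ψ := fun u : Unit → ℝ => u ())
    (by fun_prop) heval
  set R : Ω → ℝ := fun ω => ∑ j ∈ Finset.range m, Y i (j + 1) ω with hRdef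
  have hR : Measurable R := Finset.measurable_fun_sum _ fun j _ => hY.measurable _ _
  have hprod : P.map (fun ω => (R ω, Y i 0 ω)) = (P.map R).prod (P.map (Y i 0)) :=
    (indepFun_iff_map_prod_eq_prod_map_map hR.aemeasurable (hY.measurable i 0).aemeasurable).1 hind
  have hs : MeasurableSet {p : ℝ × ℝ | p.1 + p.2 = s} :=
    measurableSet_eq_fun (by fun_prop) measurable_const
  have h1 : {ω | ∑ j ∈ Finset.range (m + 1), Y i j ω = s} =
      (fun ω => (R ω, Y i 0 ω)) ⁻¹' {p : ℝ × ℝ | p.1 + p.2 = s} := by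
    ext ω
    simp [hRdef, Finset.sum_range_succ']
  rw [h1, ← Measure.map_apply (hR.prodMk (hY.measurable i 0)) hs, hprod,
    Measure.measure_prod_null hs]
  refine ae_of_all _ fun x => ?_
  have h2 : Prod.mk x ⁻¹' {p : ℝ × ℝ | p.1 + p.2 = s} = {s - x} := by
    ext z
    simp [eq_sub_iff_add_eq, add_comm]
  simp only [Pi.zero_apply]
  rw [h2, (hY.identDistrib i 0).map_eq,
    Measure.map_apply (hY.measurable 0 0) (measurableSet_singleton _)]
  exact hY.continuous_law _

/-- By the strong law the walk is eventually nonnegative, so it is almost surely bounded below; the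
events for `L = 0, 1, …` cover almost everything and cannot all be null. -/
theorem IsIIDNoise.exists_measure_forall_le_pos {X : ℕ → Ω → ℝ} (hX : IsIIDNoise P X) {δ : ℝ}
    (hδ : 0 < δ) :
    ∃ L : ℕ, 0 < P {ω | ∀ n, -(L : ℝ) ≤ ∑ j ∈ Finset.range n, (X j ω + δ)} := by
  refine exists_measure_pos_of_not_measure_iUnion_null fun hnull => ?_
  have hae : ∀ᵐ ω ∂P, ∃ L : ℕ, ∀ n, -(L : ℝ) ≤ ∑ j ∈ Finset.range n, (X j ω + δ) := by
    filter_upwards [hX.ae_tendsto_mean] with ω hω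
    have hev : ∀ᶠ n in atTop, 0 ≤ ∑ j ∈ Finset.range n, (X j ω + δ) := by
      filter_upwards [hω.eventually_const_lt (neg_lt_zero.2 hδ), eventually_gt_atTop 0] with n h1 h2
      rw [lt_div_iff₀ (by exact_mod_cast h2)] at h1
      rw [Finset.sum_add_distrib]
      simp only [Finset.sum_const, Finset.card_range, nsmul_eq_mul]
      linarith
    obtain ⟨N, hN⟩ := eventually_atTop.1 hev
    obtain ⟨L, hL⟩ := exists_nat_ge (∑ n ∈ Finset.range N, |∑ j ∈ Finset.range n, (X j ω + δ)|)
    refine ⟨L, fun n => ?_⟩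
    rcases le_or_gt N n with h | h
    · exact (neg_nonpos.2 (Nat.cast_nonneg L)).trans (hN n h)
    · have h1 := Finset.single_le_sum
        (f := fun n => |∑ j ∈ Finset.range n, (X j ω + δ)|) (fun _ _ => abs_nonneg _)
        (Finset.mem_range.2 h)
      have h2 := neg_abs_le (∑ j ∈ Finset.range n, (X j ω + δ))
      linarith
  have huniv : P (⋃ L : ℕ, {ω | ∀ n, -(L : ℝ) ≤ ∑ j ∈ Finset.range n, (X j ω + δ)}) = 1 := by
    rw [← measure_univ (μ := P)]
    refine measure_congr ?_
    filter_upwards [hae] with ω hω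
    exact propext ⟨fun _ => trivial, fun _ => Set.mem_iUnion.2 hω⟩
  rw [hnull] at huniv
  exact zero_ne_one huniv

theorem IsIIDNoise.measure_nonneg_pos {X : ℕ → Ω → ℝ} (hX : IsIIDNoise P X) (j : ℕ) :
    0 < P {ω | 0 ≤ X j ω} := by
  rw [pos_iff_ne_zero]
  intro h
  have hneg : ∀ᵐ ω ∂P, X j ω < 0 := by
    rw [ae_iff]
    simpa using h
  have h0 : ∫ ω, -X j ω ∂P = 0 := by rw [integral_neg, hX.integral_eq, neg_zero]
  rw [integral_eq_zero_iff_of_nonneg_ae (f := fun ω => -X j ω) (hneg.mono fun ω hω => by simpa using hω.le) (hX.integrable j).neg] at h0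
  obtain ⟨ω, h1, h2⟩ := (hneg.and h0).exists
  simp only [Pi.zero_apply, neg_eq_zero] at h2
  exact h1.ne h2

/-- A walk with positive drift stays nonnegative forever with positive probability. -/
theorem IsReferenceNoise.measure_forall_nonneg_pos {Y : ℕ → ℕ → Ω → ℝ}
    (hY : IsReferenceNoise P Y) {δ : ℝ} (hδ : 0 < δ) :
    0 < P {ω | ∀ n, 0 ≤ ∑ j ∈ Finset.range n, (Y 0 j ω + δ)} := by
  obtain ⟨L, hL⟩ := (hY.isIIDNoise_row 0).exists_measure_forall_le_pos hδ
  -- After `r` steps with nonnegative noise the drift alone has brought the walk to `r * δ ≥ L`; an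
  -- independent continuation that never loses more than `L` then keeps it nonnegative.
  obtain ⟨r, hr⟩ := exists_nat_ge (L / δ)
  rw [div_le_iff₀ hδ] at hr
  set A : Set (Fin r → ℝ) := {u | ∀ j, 0 ≤ u j} with hA
  set D : Set (ℕ → ℝ) := {u | ∀ n, -(L : ℝ) ≤ ∑ j ∈ Finset.range n, (u j + δ)} with hD
  have hAm : MeasurableSet A := by
    simp only [hA, Set.ofPred_forall]
    exact MeasurableSet.iInter fun j => measurableSet_le measurable_const (measurable_pi_apply j)
  have hDm : MeasurableSet D := by
    simp only [hD, Set.ofPred_forall]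
    exact MeasurableSet.iInter fun n => measurableSet_le measurable_const (by fun_prop)
  have hind := iIndepFun_indepFun_reindex hY.indep (fun p => hY.measurable _ _)
    (fun j : Fin r => (0, (j : ℕ))) (fun j : ℕ => (0, r + j)) (by
      intro a b h
      have := congrArg Prod.snd h
      have := a.2
      simp only at *
      omega)
  have hmul := hind.measure_inter_preimage_eq_mul A D hAm hDm
  have hpA : P ((fun ω (j : Fin r) => Y 0 j ω) ⁻¹' A) =
      ∏ j ∈ Finset.range r, P (Y 0 j ⁻¹' Set.Ici 0) := by
    rw [← (hY.isIIDNoise_row 0).indep.measure_inter_preimage_eq_mul (Finset.range r)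
      (sets := fun _ => Set.Ici 0) fun _ _ => measurableSet_Ici]
    congr 1
    ext ω
    simp [hA, Fin.forall_iff]
  have hpA0 : P ((fun ω (j : Fin r) => Y 0 j ω) ⁻¹' A) ≠ 0 := by
    rw [hpA, Finset.prod_ne_zero_iff]
    exact fun j _ => ((hY.isIIDNoise_row 0).measure_nonneg_pos j).ne'
  have hpD0 : P ((fun ω (j : ℕ) => Y 0 (r + j) ω) ⁻¹' D) ≠ 0 := by
    have hid := hY.identDistrib_reindex (e := fun j => (0, r + j)) (e' := fun j => (0, j))
      (fun a b h => by simpa using h) (fun a b h => by simpa using h)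
    rw [hid.measure_mem_eq hDm]
    exact hL.ne'
  refine lt_of_lt_of_le (pos_iff_ne_zero.2 (mul_ne_zero hpA0 hpD0)) (hmul ▸ measure_mono ?_)
  rintro ω ⟨h1, h2⟩ n
  have h1' : ∀ j < r, 0 ≤ Y 0 j ω := fun j hj => h1 ⟨j, hj⟩
  rcases le_or_gt n r with hn | hn
  · exact Finset.sum_nonneg fun j hj =>
      add_nonneg (h1' j ((Finset.mem_range.1 hj).trans_le hn)) hδ.le
  · obtain ⟨m, rfl⟩ := Nat.exists_eq_add_of_lt hn
    rw [add_assoc, Finset.sum_range_add]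
    have h3 : -(L : ℝ) ≤ ∑ j ∈ Finset.range (m + 1), (Y 0 (r + j) ω + δ) := h2 (m + 1)
    have h4 : ∑ j ∈ Finset.range r, δ ≤ ∑ j ∈ Finset.range r, (Y 0 j ω + δ) :=
      Finset.sum_le_sum fun j hj => by linarith [h1' j (Finset.mem_range.1 hj)]
    simp only [Finset.sum_const, Finset.card_range, nsmul_eq_mul] at h4
    linarith

end

/-! ### The cost constant, a Fatou argument, and the level of the UCB infimum. -/

section

theorem costConstant_pos {f : ℕ → ℝ} {nf : ℝ → ℕ} (hnf : IsBonusThreshold f nf) {x y z : ℝ}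
    (hx : 0 < x) (hy : 0 < y) (hz : 0 < z) : 0 < costConstant nf x y z := by
  have := hnf.one_le (x * y / (2 * z)) (by positivity)
  unfold costConstant
  positivity

/-- With `v` the exponent and `a = x / (2 * z)`, `r * exp v > r + r * v`, and `r * v` is `π ^ 2 / 6
> 1` times `1 / a ^ 2`. -/
theorem lt_costConstant {f : ℕ → ℝ} {nf : ℝ → ℕ} (hnf : IsBonusThreshold f nf) {x y z : ℝ}
    (hx : 0 < x) (hy : 0 < y) (hz : 0 < z) :
    nf (x * y / (2 * z)) + 1 / (x / (2 * z)) ^ 2 < costConstant nf x y z := by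
  have h1 := hnf.one_le (x * y / (2 * z)) (by positivity)
  unfold costConstant
  set r := nf (x * y / (2 * z))
  have hr : (0 : ℝ) < r := by exact_mod_cast h1
  set v := 2 * z ^ 2 * Real.pi ^ 2 / (3 * x ^ 2 * r) with hv
  have hv0 : 0 < v := by positivity
  have hexp := Real.add_one_lt_exp hv0.ne'
  have hpi : 6 < Real.pi ^ 2 := by nlinarith [Real.pi_gt_three]
  have h2 : (r : ℝ) * v = Real.pi ^ 2 / 6 * (1 / (x / (2 * z)) ^ 2) := by
    rw [hv]; field_simp; norm_num
  have h3 : 0 < 1 / (x / (2 * z)) ^ 2 := by positivity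
  nlinarith [mul_lt_mul_of_pos_left hexp hr]

/-- Left-continuity of the integer-valued `nf` freezes the threshold for `x` slightly below `γ`; the
remaining expression is continuous in `x`, so the strict inequality survives a small `g > 0`. -/
theorem exists_two_mul_costConstant_le {f : ℕ → ℝ} {nf : ℝ → ℕ} (hnf : IsBonusThreshold f nf)
    {γ y z c : ℝ} (hγ : 0 < γ) (hy : 0 < y) (hz : 0 < z) (hc : 2 * costConstant nf γ y z < c) :
    ∃ g ∈ Set.Ioo 0 γ, 2 * costConstant nf (γ - g) y z ≤ c := by
  have hr0 := hnf.one_le (γ * y / (2 * z)) (by positivity)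
  set r := nf (γ * y / (2 * z)) with hr
  have hr0' : (0 : ℝ) < r := by exact_mod_cast hr0
  have hcont : ContinuousAt (fun x : ℝ => 2 * ((r : ℝ) *
      Real.exp (2 * z ^ 2 * Real.pi ^ 2 / (3 * x ^ 2 * r)))) γ := by
    have : 3 * γ ^ 2 * (r : ℝ) ≠ 0 := by positivity
    fun_prop (disch := assumption)
  have hsub : Tendsto (fun g : ℝ => γ - g) (𝓝[>] 0) (𝓝[<] γ) := by
    refine tendsto_nhdsWithin_iff.2 ⟨?_, ?_⟩
    · have : Tendsto (fun g : ℝ => γ - g) (𝓝 0) (𝓝 (γ - 0)) := by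
        exact (continuous_const.sub continuous_id).tendsto 0
      rw [sub_zero] at this
      exact this.mono_left nhdsWithin_le_nhds
    · filter_upwards [self_mem_nhdsWithin] with g hg
      have : 0 < g := hg
      simpa using this
  have hscale : Tendsto (fun x : ℝ => x * y / (2 * z)) (𝓝[<] γ) (𝓝[<] (γ * y / (2 * z))) := by
    refine tendsto_nhdsWithin_iff.2 ⟨?_, ?_⟩
    · exact ((continuous_id.mul continuous_const).div_const _ |>.tendsto γ).mono_left
        nhdsWithin_le_nhds
    · filter_upwards [self_mem_nhdsWithin] with x hx
      have : x < γ := hx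
      simp only [Set.mem_Iio]
      gcongr
  have h1 := (hscale.comp hsub).eventually (hnf.left_continuous _ (by positivity))
  have h2 := (hsub.mono_right nhdsWithin_le_nhds).eventually
    (hcont.eventually_lt_const (show _ < c from hc))
  have h3 : ∀ᶠ g in 𝓝[>] (0 : ℝ), g ∈ Set.Ioo 0 γ := Ioo_mem_nhdsGT hγ
  obtain ⟨g, hg1, hg2, hg3⟩ := (h1.and (h2.and h3)).exists
  refine ⟨g, hg3, ?_⟩
  unfold costConstant
  simp only [Function.comp_apply] at hg1
  rw [hg1, ← hr]
  exact hg2.le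

/-- The UCB value of an inferior alternative is below the level `M` at a time after which its
exploration bonus is small and at which the mean of its noise is small. -/
theorem ucbValue_lt_of_sum_le {f : ℕ → ℝ} {nf : ℝ → ℕ} (hnf : IsBonusThreshold f nf)
    {x lo hi m s M : ℝ} (hx : 0 < x) (hlo : 0 < lo) (hs : lo ≤ s) (hs' : s ≤ hi)
    (hm : m + x ≤ M) {y : ℕ → ℝ} {n : ℕ} (hn : nf (x * lo / (2 * hi)) ≤ n)
    (hy : ∑ j ∈ Finset.range n, y j ≤ x / (2 * hi) * n) :
    ucbValue f (observations m s y) n < M := by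
  have hs0 : 0 < s := hlo.trans_le hs
  have hhi : 0 < hi := hs0.trans_le hs'
  have hb : 0 < x * lo / (2 * hi) := by positivity
  have h1 : 1 ≤ n := (hnf.one_le _ hb).trans hn
  have h2 := hnf.lt_of_le _ hb n hn
  rw [ucbValue_observations f m s y h1]
  have h3 : (∑ j ∈ Finset.range n, y j) / n ≤ x / (2 * hi) := by
    rwa [div_le_iff₀ (by exact_mod_cast h1)]
  have h4 : s * ((∑ j ∈ Finset.range n, y j) / n) ≤ hi * (x / (2 * hi)) :=
    (mul_le_mul_of_nonneg_left h3 hs0.le).trans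
      (mul_le_mul_of_nonneg_right hs' (by positivity))
  have h5 : hi * (x / (2 * hi)) = x / 2 := by field_simp
  -- The gap `x` is split in halves: noise takes at most one, and the bonus takes less than the
  -- other since `lo ≤ hi`.
  have h6 : x * lo / (2 * hi) ≤ x / 2 := by
    rw [div_le_div_iff₀ (by positivity) (by norm_num)]
    nlinarith [mul_le_mul_of_nonneg_left (hs.trans hs') hx.le]
  linarith

/-- Up to a null set, `E` lies in the increasing union of the tail intersections `⋂ k ≥ K, A k`;
continuity from below gives the bound and needs no measurability. -/
theorem le_liminf_measureReal_of_ae_eventually {Ω : Type*} [MeasurableSpace Ω] {P : Measure Ω}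
    [IsProbabilityMeasure P] {E : Set Ω} {A : ℕ → Set Ω}
    (h : ∀ᵐ ω ∂P, ω ∈ E → ∀ᶠ k in atTop, ω ∈ A k) :
    P.real E ≤ liminf (fun k => P.real (A k)) atTop := by
  set D : ℕ → Set Ω := fun K => ⋂ k ≥ K, A k with hD
  have hmono : Monotone D := fun K K' hK => by
    simp only [hD]
    exact Set.biInter_subset_biInter_left fun k hk => le_trans hK hk
  have hlim : Tendsto (fun K => P.real (D K)) atTop (𝓝 (P.real (⋃ K, D K))) :=
    (ENNReal.tendsto_toReal (measure_ne_top _ _)).comp (tendsto_measure_iUnion_atTop hmono)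
  have hE : P.real E ≤ P.real (⋃ K, D K) := by
    refine ENNReal.toReal_mono (measure_ne_top _ _) (measure_mono_ae ?_)
    filter_upwards [h] with ω hω hωE
    obtain ⟨K, hK⟩ := eventually_atTop.1 (hω hωE)
    exact Set.mem_iUnion.2 ⟨K, Set.mem_iInter₂.2 hK⟩
  refine hE.trans ?_
  rw [← hlim.liminf_eq]
  refine liminf_le_liminf (Eventually.of_forall fun K => ?_) ?_ ?_
  · exact measureReal_mono (Set.biInter_subset_of_mem (le_refl K))
  · exact isBoundedUnder_of ⟨0, fun _ => measureReal_nonneg⟩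
  · exact (isBoundedUnder_of ⟨1, fun _ => measureReal_le_one⟩).isCoboundedUnder_ge

variable {Ω : Type*} [MeasurableSpace Ω] {P : Measure Ω} [IsProbabilityMeasure P]

theorem IsReferenceNoise.ae_tendsto_ucbValue {Y : ℕ → ℕ → Ω → ℝ} (hY : IsReferenceNoise P Y)
    {f : ℕ → ℝ} (hf : IsBonusFunction f) (m s : ℝ) (i : ℕ) :
    ∀ᵐ ω ∂P, Tendsto (ucbValue f (observations m s fun j => Y i j ω)) atTop (𝓝 m) := by
  filter_upwards [(hY.isIIDNoise_row i).ae_tendsto_mean] with ω hω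
  have h := ((hω.const_mul s).const_add m).add hf.tendsto_zero
  simp only [mul_zero, add_zero] at h
  refine h.congr' ?_
  filter_upwards [eventually_ge_atTop 1] with n hn
  rw [ucbValue_observations f m s _ hn]

theorem IsReferenceNoise.ae_ucbValue_ne {Y : ℕ → ℕ → Ω → ℝ} (hY : IsReferenceNoise P Y)
    (f : ℕ → ℝ) (m : ℝ) {s : ℝ} (hs : 0 < s) (i : ℕ) (M : ℝ) :
    ∀ᵐ ω ∂P, ∀ n, 1 ≤ n → ucbValue f (observations m s fun j => Y i j ω) n ≠ M := by
  rw [ae_all_iff]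
  intro n
  by_cases hn : 1 ≤ n
  · have h := hY.measure_sum_eq_zero i hn ((M - f n - m) / s * n)
    have h' : ∀ᵐ ω ∂P, ∑ j ∈ Finset.range n, Y i j ω ≠ (M - f n - m) / s * n := by
      rw [ae_iff]; simpa using h
    filter_upwards [h'] with ω hω _ hM
    apply hω
    rw [ucbValue_observations f m s _ hn] at hM
    have : (n : ℝ) ≠ 0 := by positivity
    rw [← hM]
    field_simp
    ring
  · exact ae_of_all _ fun ω h => absurd h hn

/-- The infimum of the UCB values almost surely does not hit a level below the mean. -/
theorem IsReferenceNoise.ae_exists_lt_of_le_ucbInf {Y : ℕ → ℕ → Ω → ℝ}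
    (hY : IsReferenceNoise P Y) {f : ℕ → ℝ} (hf : IsBonusFunction f) (m : ℝ) {s : ℝ}
    (hs : 0 < s) (i : ℕ) {g₀ : ℝ} (hg₀ : 0 < g₀) :
    ∀ᵐ ω ∂P, ((m - g₀ : ℝ) : EReal) ≤ ucbInf f (observations m s fun j => Y i j ω) →
      ∃ g < g₀, ((m - g : ℝ) : EReal) ≤ ucbInf f (observations m s fun j => Y i j ω) := by
  filter_upwards [hY.ae_tendsto_ucbValue hf m s i, hY.ae_ucbValue_ne f m hs i (m - g₀)]
    with ω hlim hne hle
  simp only [le_ucbInf_iff] at hle ⊢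
  set U := ucbValue f (observations m s fun j => Y i j ω)
  obtain ⟨N, hN⟩ := eventually_atTop.1
    (hlim.eventually_const_le (show m - g₀ / 2 < m by linarith))
  -- Beyond `N` the deficit `m - U n` is at most `g₀ / 2`; the finitely many earlier deficits are
  -- strictly below `g₀` because no `U n` hits the level. Their maximum is the new `g`.
  let F : Finset ℝ := insert (g₀ / 2) ((Finset.Icc 1 N).image fun n => m - U n)
  have hF : F.Nonempty := ⟨g₀ / 2, Finset.mem_insert_self _ _⟩
  refine ⟨F.max' hF, ?_, fun n hn => ?_⟩
  · rw [Finset.max'_lt_iff]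
    intro x hx
    simp only [F, Finset.mem_insert, Finset.mem_image, Finset.mem_Icc] at hx
    rcases hx with rfl | ⟨n, hn, rfl⟩
    · linarith
    · linarith [lt_of_le_of_ne (hle n hn.1) (hne n hn.1).symm]
  · rcases le_total N n with h | h
    · linarith [hN n h, F.le_max' (g₀ / 2) (Finset.mem_insert_self _ _)]
    · linarith [F.le_max' (m - U n) (Finset.mem_insert_of_mem
        (Finset.mem_image_of_mem _ (Finset.mem_Icc.2 ⟨hn, h⟩)))]

/-- If the walk with drift `g / s` stays nonnegative, every noise mean is at least `-(g / s)`;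
scaling by `s` costs at most `g`, and the bonus is nonnegative. -/
theorem IsReferenceNoise.measureReal_le_ucbInf_pos {Y : ℕ → ℕ → Ω → ℝ}
    (hY : IsReferenceNoise P Y) {f : ℕ → ℝ} (hf : IsBonusFunction f) (m : ℝ) {s : ℝ}
    (hs : 0 < s) {g : ℝ} (hg : 0 < g) :
    0 < P.real {ω | ((m - g : ℝ) : EReal) ≤ ucbInf f (observations m s fun j => Y 0 j ω)} := by
  rw [measureReal_def, ENNReal.toReal_pos_iff]
  refine ⟨(hY.measure_forall_nonneg_pos (div_pos hg hs)).trans_le (measure_mono ?_),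
    measure_lt_top _ _⟩
  intro ω hω
  simp only [Set.mem_ofPred_eq, le_ucbInf_iff] at hω ⊢
  intro n hn
  have h := hω n
  rw [Finset.sum_add_distrib] at h
  simp only [Finset.sum_const, Finset.card_range, nsmul_eq_mul] at h
  rw [ucbValue_observations f m s _ hn]
  have hn0 : (0 : ℝ) < n := by exact_mod_cast hn
  have h1 : -(g / s) ≤ (∑ j ∈ Finset.range n, Y 0 j ω) / n := by
    rw [le_div_iff₀ hn0]; linarith
  have h2 : s * -(g / s) ≤ s * ((∑ j ∈ Finset.range n, Y 0 j ω) / n) := by gcongr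
  have h3 : s * -(g / s) = -g := by field_simp
  linarith [hf.nonneg n hn]

end

/-! ### The main theorem. -/

/-- For each number `k` of alternatives, the alternatives are `0, …, k - 1`, where `0` is the best
one; `μ k i` and `σ k i` are the mean and standard deviation of alternative `i`. Alternative `0` is
the same for all `k`; the others may vary with `k`. `sel k B` is the alternative which the
algorithm returns with `k` alternatives and budget `B`. -/
theorem theorem1 {Ω : Type*} [MeasurableSpace Ω] (P : Measure Ω) [IsProbabilityMeasure P]
    (f : ℕ → ℝ) (hf : IsBonusFunction f)
    (nf : ℝ → ℕ) (hnf : IsBonusThreshold f nf)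
    (Y : ℕ → ℕ → Ω → ℝ) (hY : IsReferenceNoise P Y)
    (μ₁ σ₁ : ℝ) (μ σ : ℕ → ℕ → ℝ)
    (hμ₁ : ∀ k, 1 ≤ k → μ k 0 = μ₁) (hσ₁ : ∀ k, 1 ≤ k → σ k 0 = σ₁)
    (γ σlo σhi : ℝ) (hγ : 0 < γ) (hσlo : 0 < σlo) (hσhi : 0 < σhi)
    (hgap : ∀ k i, 1 ≤ i → i < k → γ ≤ μ₁ - μ k i)
    (hσ : ∀ k i, i < k → σlo ≤ σ k i ∧ σ k i ≤ σhi)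
    (sel : ℕ → ℝ → Ω → ℕ) (hsel_meas : ∀ k B, Measurable (sel k B))
    (hsel : ∀ k, 1 ≤ k → ∀ B ω, IsMetaUCBOutput k B
      (fun i => ucbValue f (observations (μ k i) (σ k i) (fun j => Y i j ω))) (sel k B ω))
    (c : ℝ) (hc : 2 * costConstant nf γ σlo σhi < c) :
    (∃ γ₀ : ℝ,
      IsLUB {g : ℝ | g ∈ Set.Ioo 0 γ ∧ 2 * costConstant nf (γ - g) σlo σhi ≤ c} γ₀ ∧
      P.real {ω | ((μ₁ - γ₀ : ℝ) : EReal) ≤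
          ucbInf f (observations μ₁ σ₁ (fun j => Y 0 j ω))} ≤
        liminf (fun k : ℕ => P.real {ω | sel k (c * k) ω = 0}) atTop ∧
      0 < P.real {ω | ((μ₁ - γ₀ : ℝ) : EReal) ≤
          ucbInf f (observations μ₁ σ₁ (fun j => Y 0 j ω))}) ∧
    IsSampleOptimal (fun k B => P.real {ω | sel k B ω = 0}) := by
  set S : Set ℝ := {g : ℝ | g ∈ Set.Ioo 0 γ ∧ 2 * costConstant nf (γ - g) σlo σhi ≤ c} with hS
  obtain ⟨g₁, hg₁, hg₁c⟩ := exists_two_mul_costConstant_le hnf hγ hσlo hσhi hc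
  have hg₁S : g₁ ∈ S := ⟨hg₁, hg₁c⟩
  have hlub : IsLUB S (sSup S) :=
    isLUB_csSup ⟨g₁, hg₁S⟩ ⟨γ, fun g hg => hg.1.2.le⟩
  set γ₀ := sSup S
  have hγ₀ : 0 < γ₀ := hg₁.1.trans_le (hlub.1 hg₁S)
  have hσ₁pos : 0 < σ₁ := by
    rw [← hσ₁ 1 le_rfl]
    exact hσlo.trans_le (hσ 1 0 one_pos).1
  -- For a fixed admissible `g`, almost every path whose UCB infimum is at least `μ₁ - g` gives the
  -- correct selection for all large `k`.
  have hlevel : ∀ g ∈ S, ∀ᵐ ω ∂P,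
      ((μ₁ - g : ℝ) : EReal) ≤ ucbInf f (observations μ₁ σ₁ fun j => Y 0 j ω) →
        ∀ᶠ k : ℕ in atTop, sel k (c * k) ω = 0 := by
    rintro g ⟨⟨hg0, hgγ⟩, hgc⟩
    have hx : 0 < γ - g := sub_pos.2 hgγ
    have ha : 0 < (γ - g) / (2 * σhi) := by positivity
    have hr : 1 ≤ nf ((γ - g) * σlo / (2 * σhi)) := hnf.one_le _ (by positivity)
    have hlt : (nf ((γ - g) * σlo / (2 * σhi)) : ℝ) + 1 / ((γ - g) / (2 * σhi)) ^ 2 < c / 2 := by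
      linarith [lt_costConstant hnf hx hσlo hσhi]
    filter_upwards [hY.ae_eventually_sum_passageTime_lt ha hr hlt,
      hY.ae_forall_exists_le ha (nf ((γ - g) * σlo / (2 * σhi)))] with ω hsum hex hinf
    rw [le_ucbInf_iff] at hinf
    filter_upwards [hsum, eventually_ge_atTop 1] with k hk hk1
    refine (hsel k hk1 (c * k) ω).eq_zero (L := μ₁ - g)
      (N := fun i => passageTime ((γ - g) / (2 * σhi)) (nf ((γ - g) * σlo / (2 * σhi)))
        (fun j => Y i j ω)) ?_ ?_ ?_ (by linarith)
    · intro n hn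
      simp only [hμ₁ k hk1, hσ₁ k hk1]
      exact hinf n hn
    · exact fun i _ _ => hr.trans (passageTime_spec (hex i)).1
    · intro i hi hik
      obtain ⟨h1, h2⟩ := passageTime_spec (hex i)
      exact ucbValue_lt_of_sum_le hnf hx hσlo (hσ k i hik).1 (hσ k i hik).2
        (by linarith [hgap k i hi hik]) h1 h2
  -- A sequence in `S` tending to `γ₀` keeps the exceptional null sets countable in number.
  obtain ⟨u, -, -, hu, huS⟩ := hlub.exists_seq_monotone_tendsto ⟨g₁, hg₁S⟩
  have hliminf : P.real {ω | ((μ₁ - γ₀ : ℝ) : EReal) ≤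
      ucbInf f (observations μ₁ σ₁ (fun j => Y 0 j ω))} ≤
        liminf (fun k : ℕ => P.real {ω | sel k (c * k) ω = 0}) atTop := by
    refine le_liminf_measureReal_of_ae_eventually ?_
    filter_upwards [ae_all_iff.2 fun n => hlevel (u n) (huS n),
      hY.ae_exists_lt_of_le_ucbInf hf μ₁ hσ₁pos 0 hγ₀] with ω hall hex hω
    obtain ⟨g, hg, hginf⟩ := hex hω
    obtain ⟨n, hn⟩ := (hu.eventually_const_lt hg).exists
    exact hall n (le_trans (EReal.coe_le_coe_iff.2 (by linarith)) hginf)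
  have hpos := hY.measureReal_le_ucbInf_pos hf μ₁ hσ₁pos hγ₀
  -- Half of the limiting probability serves as `α`, giving the strict inequality and `α < 1`.
  refine ⟨⟨γ₀, hlub, hliminf, hpos⟩, _, ⟨half_pos hpos, ?_⟩, c, ?_,
    (half_lt_self hpos).trans_le hliminf⟩
  · exact (half_lt_self hpos).trans_le measureReal_le_one
  · linarith [costConstant_pos hnf hγ hσlo hσhi]
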